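/- Let $K$ be a field, $S=K[x_1,\ldots,x_n]$, and let $M=(m_1,\ldots,m_q)$ be a squarefree monomial ideal of $S$ (an ideal that can be generated by squarefree monomials), where $m_1,\ldots,m_q$ are monomials. Suppose that $\deg(m_1),\ldots,\deg(m_q)>k$ for some integer $k\ge 0$; if $M=0$, assume also that $k\le n$. Then $$\operatorname{pd}(S/M)\le n-k .$$ Here $\operatorname{pd}$ may be read in either of its two usual senses: the projective dimension of the $S$-module $S/M$ is at most $n-k$; and in every minimal multigraded free resolution $\cdots\to F_1\to F_0\to S/M\to 0$ (free modules of finite rank with multihomogeneous bases, multidegree-preserving maps, and differential matrices $F_{i+1}\to F_i$ without invertible entries) the Betti numbers satisfy $\operatorname{rank}(F_i)=0$ for all $i>n-k$. -/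

import Mathlib

/-- The ideal of `K[x_1, …, x_n]` generated by the monomials `x ^ a`, `a ∈ A`. -/
noncomputable def monomialIdeal {K : Type*} [Field K] {n : ℕ} (A : Set (Fin n →₀ ℕ)) :
    Ideal (MvPolynomial (Fin n) K) :=
  Ideal.span ((fun a => MvPolynomial.monomial a (1 : K)) '' A)

/-- A squarefree monomial ideal: an ideal generated by squarefree monomials. -/
def IsSquarefreeMonomialIdeal {K : Type*} [Field K] {n : ℕ}
    (M : Ideal (MvPolynomial (Fin n) K)) : Prop :=
  ∃ A : Set (Fin n →₀ ℕ),
    (∀ a ∈ A, Squarefree (MvPolynomial.monomial a (1 : K))) ∧ M = monomialIdeal A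

/-- A multigraded free resolution
`⋯ → F_{i+1} → F_i → ⋯ → F_0 → S / M → 0` of `S / M` over `S = K[x_1, …, x_n]`, by free modules
of finite rank: `F_i = S ^ (rank i)` with its standard basis, whose elements have multidegrees
`mdeg i`, and `d i` is the matrix of the differential `F_{i+1} → F_i` in these bases. -/
structure MultigradedFreeResolution {K : Type*} [Field K] {n : ℕ}
    (M : Ideal (MvPolynomial (Fin n) K)) where
  rank : ℕ → ℕ
  mdeg : ∀ i : ℕ, Fin (rank i) → (Fin n →₀ ℕ)
  d : ∀ i : ℕ, Matrix (Fin (rank i)) (Fin (rank (i + 1))) (MvPolynomial (Fin n) K)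
  aug : (Fin (rank 0) → MvPolynomial (Fin n) K) →ₗ[MvPolynomial (Fin n) K]
    (MvPolynomial (Fin n) K ⧸ M)
  aug_surjective : Function.Surjective aug
  exact_zero : Function.Exact (d 0).mulVecLin aug
  exact_succ : ∀ i : ℕ, Function.Exact (d (i + 1)).mulVecLin (d i).mulVecLin
  /-- The augmentation preserves multidegrees. -/
  aug_homogeneous : ∀ τ : Fin (rank 0), ∃ c : K,
    aug (Pi.single τ 1) = Ideal.Quotient.mk M (MvPolynomial.monomial (mdeg 0 τ) c)
  /-- The differentials preserve multidegrees: a nonzero entry is a scalar times the monomial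
  by which the multidegrees of source and target differ. -/
  d_homogeneous : ∀ (i : ℕ) (τ : Fin (rank i)) (σ : Fin (rank (i + 1))), d i τ σ = 0 ∨
    ∃ (e : Fin n →₀ ℕ) (c : K), mdeg (i + 1) σ = mdeg i τ + e ∧
      d i τ σ = MvPolynomial.monomial e c

/-- A resolution is minimal if no differential matrix has an invertible entry. For a minimal
resolution, `F.rank i` is the `i`-th Betti number of `S / M`. -/
def MultigradedFreeResolution.IsMinimal {K : Type*} [Field K] {n : ℕ}
    {M : Ideal (MvPolynomial (Fin n) K)} (F : MultigradedFreeResolution M) : Prop :=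
  ∀ (i : ℕ) (τ : Fin (F.rank i)) (σ : Fin (F.rank (i + 1))), ¬ IsUnit (F.d i τ σ)

/-! For a variable `x` and a squarefree monomial ideal `I`, the sequence 0 → S/(I : x) → S/I → S/(I
+ (x)) → 0 bounds pd(S/I) by the larger of the two outer dimensions. Split on the variables one at a
time. With `W` the untouched variables, `T` those already in the ideal, and generators avoiding `T`
having degree above `k`, the bound |W| + |T| - k survives both branches: the colon loses one from
`W` and at most one from `k`, the sum moves `x` from `W` to `T`. Once k = |W|, only the variables of
`T` (or 1) generate. For minimal resolutions, a syzygy that has become projective forces the next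
free module to vanish, by Nakayama. -/

open CategoryTheory in
/-- The sequence `0 → R / (I : x) → R / I → R / (I + (x)) → 0` bounds projective dimensions. -/
theorem exists_shortExact_colon {R : Type*} [CommRing R] (I J : Ideal R) (x : R)
    (hJ : ∀ f, f ∈ J ↔ x * f ∈ I) :
    ∃ S : ShortComplex (ModuleCat R), S.ShortExact ∧ S.X₁ = ModuleCat.of R (R ⧸ J) ∧
      S.X₂ = ModuleCat.of R (R ⧸ I) ∧ S.X₃ = ModuleCat.of R (R ⧸ (I ⊔ Ideal.span {x})) := by
  let f : (R ⧸ J) →ₗ[R] (R ⧸ I) :=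
    Submodule.mapQ J I (LinearMap.lsmul R R x) fun a ha => by simpa using (hJ a).1 ha
  let g : (R ⧸ I) →ₗ[R] (R ⧸ (I ⊔ Ideal.span {x})) := Submodule.factor le_sup_left
  have hf : Function.Injective f := by
    rw [injective_iff_map_eq_zero]
    intro a ha
    obtain ⟨a, rfl⟩ := Submodule.Quotient.mk_surjective J a
    rw [Submodule.mapQ_apply, Submodule.Quotient.mk_eq_zero] at ha
    rw [Submodule.Quotient.mk_eq_zero, hJ]
    simpa using ha
  have hg : Function.Surjective g := Submodule.factor_surjective _
  have hfg : Function.Exact f g := by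
    intro b
    obtain ⟨b, rfl⟩ := Submodule.Quotient.mk_surjective I b
    have hb : g (Submodule.Quotient.mk b) = Submodule.Quotient.mk b := rfl
    rw [hb, Submodule.Quotient.mk_eq_zero, Submodule.mem_sup]
    constructor
    · rintro ⟨y, hy, z, hz, rfl⟩
      obtain ⟨c, rfl⟩ := Ideal.mem_span_singleton'.1 hz
      refine ⟨Submodule.Quotient.mk c, ?_⟩
      rw [Submodule.mapQ_apply, Submodule.Quotient.eq]
      have : x • c - (y + c * x) = -y := by simp only [smul_eq_mul]; ring
      simpa only [LinearMap.lsmul_apply, this] using I.neg_mem hy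
    · rintro ⟨c, hc⟩
      obtain ⟨c, rfl⟩ := Submodule.Quotient.mk_surjective J c
      rw [Submodule.mapQ_apply, Submodule.Quotient.eq] at hc
      refine ⟨b - x * c, ?_, x * c, Ideal.mul_mem_right _ _ (Ideal.mem_span_singleton_self x),
        by ring⟩
      rw [← neg_sub]
      exact I.neg_mem hc
  exact ⟨ShortComplex.mk (ModuleCat.ofHom f) (ModuleCat.ofHom g)
      (by ext1; exact hfg.linearMap_comp_eq_zero),
    { exact := (ShortComplex.ShortExact.moduleCat_exact_iff_function_exact _).2 hfg
      mono_f := (ModuleCat.mono_iff_injective _).2 hf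
      epi_g := (ModuleCat.epi_iff_surjective _).2 hg }, rfl, rfl, rfl⟩

open CategoryTheory in
/-- A syzygy of a module of projective dimension `≤ p + 1` has projective dimension `≤ p`. -/
theorem hasProjectiveDimensionLT_ker.{u} {R F Q : Type u} [CommRing R]
    [AddCommGroup F] [Module R F] [AddCommGroup Q] [Module R Q] [Module.Projective R F]
    (f : F →ₗ[R] Q) (hf : Function.Surjective f) (p : ℕ)
    (h : HasProjectiveDimensionLT (ModuleCat.of R Q) (p + 2)) :
    HasProjectiveDimensionLT (ModuleCat.of R (LinearMap.ker f)) (p + 1) := by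
  have hfg : Function.Exact (LinearMap.ker f).subtype f := LinearMap.exact_subtype_ker_map f
  let S : ShortComplex (ModuleCat R) := ShortComplex.mk
    (ModuleCat.ofHom (LinearMap.ker f).subtype) (ModuleCat.ofHom f)
    (by ext1; exact hfg.linearMap_comp_eq_zero)
  have hS : S.ShortExact :=
    { exact := (ShortComplex.ShortExact.moduleCat_exact_iff_function_exact _).2 hfg
      mono_f := (ModuleCat.mono_iff_injective _).2 (Submodule.injective_subtype _)
      epi_g := (ModuleCat.epi_iff_surjective _).2 hf }
  have h₂ : Projective S.X₂ := (IsProjective.iff_projective F).1 inferInstance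
  exact (hS.hasProjectiveDimensionLT_X₃_iff p h₂).1 h

/-! ### Length of minimal resolutions -/

/-- If `D'`, `D` are consecutive maps of a minimal free resolution and the cokernel of `D` is
projective, then the source of `D` vanishes. -/
theorem rank_eq_zero_of_projective_of_minimal {R : Type*} [CommRing R] [IsDomain R] {𝔪 : Ideal R}
    (h𝔪 : 𝔪 ≠ ⊤) {a b c : ℕ} {P : Type*} [AddCommGroup P] [Module R P] [Module.Projective R P]
    (f : (Fin a → R) →ₗ[R] P) (hf : Function.Surjective f)
    (D : Matrix (Fin a) (Fin b) R) (D' : Matrix (Fin b) (Fin c) R)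
    (hDf : Function.Exact D.mulVecLin f) (hD' : Function.Exact D'.mulVecLin D.mulVecLin)
    (hD : ∀ i j, D i j ∈ 𝔪) (hD'm : ∀ i j, D' i j ∈ 𝔪) : b = 0 := by
  obtain ⟨s, hs⟩ := Module.projective_lifting_property f LinearMap.id hf
  have hs' : ∀ y, f (s y) = y := fun y => LinearMap.congr_fun hs y
  set N := LinearMap.ker f with hN
  have hrange : N = LinearMap.range D.mulVecLin := by
    ext y
    exact hDf y
  have hfg : N.FG := by
    rw [hrange, LinearMap.range_eq_map]
    exact Submodule.FG.map _ Module.Finite.fg_top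
  let π : (Fin a → R) →ₗ[R] (Fin a → R) := LinearMap.id - s ∘ₗ f
  have hπ : ∀ y, π y ∈ N := fun y => by simp [π, hN, hs']
  -- `π` projects onto `N`, and the coordinates of elements of `N` lie in `𝔪`.
  have hle : N ≤ 𝔪 • N := by
    intro y hy
    have hπy : π y = y := by
      have : f y = 0 := hy
      simp [π, this]
    obtain ⟨z, rfl⟩ := (hDf y).1 hy
    rw [← hπy, ← LinearMap.sum_single_apply (fun _ => R) (D.mulVecLin z), map_sum]
    refine Submodule.sum_mem _ fun i _ => ?_
    have h1 : (Pi.single i (D.mulVecLin z i) : Fin a → R) =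
        D.mulVecLin z i • Pi.single i (1 : R) := by
      rw [← Pi.single_smul]; simp
    rw [h1, map_smul]
    refine Submodule.smul_mem_smul ?_ (hπ _)
    rw [Matrix.mulVecLin_apply, Matrix.mulVec, dotProduct]
    exact Ideal.sum_mem _ fun j _ => Ideal.mul_mem_right _ _ (hD i j)
  -- Nakayama without a local ring: `r` ≡ 1 mod `𝔪` kills the torsion-free `N`, so `D` = 0 and `D'`
  -- is surjective.
  obtain ⟨r, hr, hr0⟩ := Submodule.exists_sub_one_mem_and_smul_eq_zero_of_fg_of_le_smul 𝔪 N hfg hle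
  have hr_ne : r ≠ 0 := by
    rintro rfl
    refine h𝔪 ((Ideal.eq_top_iff_one _).2 ?_)
    simpa using 𝔪.neg_mem hr
  have hzero : ∀ z, D.mulVecLin z = 0 := fun z =>
    (smul_eq_zero.1 (hr0 _ ((hDf _).2 ⟨z, rfl⟩))).resolve_left hr_ne
  by_contra hb
  let i : Fin b := ⟨0, Nat.pos_of_ne_zero hb⟩
  obtain ⟨z, hz⟩ := (hD' (Pi.single i 1)).1 (hzero _)
  refine h𝔪 ((Ideal.eq_top_iff_one _).2 ?_)
  have h1 : (D'.mulVecLin z) i = 1 := by rw [hz]; simp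
  rw [← h1, Matrix.mulVecLin_apply, Matrix.mulVec, dotProduct]
  exact Ideal.sum_mem _ fun j _ => Ideal.mul_mem_right _ _ (hD'm i j)

open CategoryTheory in
/-- A minimal multigraded free resolution is no longer than the projective dimension. -/
theorem MultigradedFreeResolution.IsMinimal.rank_succ_eq_zero {K : Type*} [Field K] {n : ℕ}
    {M : Ideal (MvPolynomial (Fin n) K)} {F : MultigradedFreeResolution M} (hF : F.IsMinimal)
    (i : ℕ) (h : HasProjectiveDimensionLE
      (ModuleCat.of (MvPolynomial (Fin n) K) (MvPolynomial (Fin n) K ⧸ M)) i) :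
    F.rank (i + 1) = 0 := by
  let 𝔪 : Ideal (MvPolynomial (Fin n) K) :=
    RingHom.ker (MvPolynomial.constantCoeff (σ := Fin n) (R := K))
  have h𝔪 : 𝔪 ≠ ⊤ := RingHom.ker_ne_top _
  -- Homogeneous entries are single terms, so a nonunit has no constant term.
  have hd : ∀ i τ σ, F.d i τ σ ∈ 𝔪 := by
    intro i τ σ
    rcases F.d_homogeneous i τ σ with h0 | ⟨e, c, -, hec⟩
    · rw [h0]; exact 𝔪.zero_mem
    · have hu := hF i τ σ
      rw [hec] at hu ⊢
      rw [RingHom.mem_ker, MvPolynomial.constantCoeff_monomial]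
      split_ifs with he
      · subst he
        by_contra hc
        exact hu ((isUnit_iff_ne_zero.2 hc).map MvPolynomial.C)
      · rfl
  have key : ∀ j p : ℕ, HasProjectiveDimensionLT
      (ModuleCat.of (MvPolynomial (Fin n) K) (MvPolynomial (Fin n) K ⧸ M)) (p + j + 2) →
      HasProjectiveDimensionLT (ModuleCat.of (MvPolynomial (Fin n) K)
        (LinearMap.range (F.d j).mulVecLin)) (p + 1) := by
    intro j
    induction j with
    | zero =>
      intro p hp
      rw [← LinearMap.exact_iff.1 F.exact_zero]
      exact hasProjectiveDimensionLT_ker F.aug F.aug_surjective p hp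
    | succ j ih =>
      intro p hp
      have h1 := ih (p + 1) (by convert hp using 1; ring)
      have h2 := hasProjectiveDimensionLT_ker _ (F.d j).mulVecLin.surjective_rangeRestrict p h1
      rwa [LinearMap.ker_rangeRestrict, LinearMap.exact_iff.1 (F.exact_succ j)] at h2
  cases i with
  | zero =>
    have hP := projective_iff_hasProjectiveDimensionLE_zero _ |>.2 h
    have : Module.Projective (MvPolynomial (Fin n) K) (MvPolynomial (Fin n) K ⧸ M) :=
      (IsProjective.iff_projective _).2 hP
    exact rank_eq_zero_of_projective_of_minimal h𝔪 F.aug F.aug_surjective _ _ F.exact_zero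
      (F.exact_succ 0) (hd 0) (hd 1)
  | succ i =>
    have hP := projective_iff_hasProjectiveDimensionLT_one.2
      (key i 0 (by convert h using 1; ring))
    have : Module.Projective (MvPolynomial (Fin n) K) (LinearMap.range (F.d i).mulVecLin) :=
      (IsProjective.iff_projective _).2 hP
    refine rank_eq_zero_of_projective_of_minimal h𝔪 _ (F.d i).mulVecLin.surjective_rangeRestrict _ _
      ?_ (F.exact_succ (i + 1)) (hd (i + 1)) (hd (i + 2))
    rw [LinearMap.exact_iff, LinearMap.ker_rangeRestrict]
    exact LinearMap.exact_iff.1 (F.exact_succ i)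

/-! ### Squarefree monomial ideals as families of finite sets -/

/-- The squarefree monomial ideal generated by the products `∏ i ∈ s, x_i`, `s ∈ 𝒜`. -/
noncomputable def squarefreeIdeal (K : Type*) [Field K] {n : ℕ} (𝒜 : Set (Finset (Fin n))) :
    Ideal (MvPolynomial (Fin n) K) :=
  monomialIdeal {a | (∀ i, a i ≤ 1) ∧ a.support ∈ 𝒜}

theorem Finsupp.le_iff_support_subset_of_le_one {ι : Type*} {a b : ι →₀ ℕ} (ha : ∀ i, a i ≤ 1) :
    a ≤ b ↔ a.support ⊆ b.support := by
  refine ⟨Finsupp.support_mono, fun h i => ?_⟩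
  by_cases hi : a i = 0
  · omega
  · have := Finsupp.mem_support_iff.1 (h (Finsupp.mem_support_iff.2 hi))
    have := ha i
    omega

section squarefreeIdeal

variable {K : Type*} [Field K] {n : ℕ}

theorem mem_squarefreeIdeal {𝒜 : Set (Finset (Fin n))} {f : MvPolynomial (Fin n) K} :
    f ∈ squarefreeIdeal K 𝒜 ↔ ∀ e ∈ f.support, ∃ s ∈ 𝒜, s ⊆ e.support := by
  refine MvPolynomial.mem_ideal_span_monomial_image.trans (forall₂_congr fun e _ => ?_)
  constructor
  · rintro ⟨a, ⟨-, ha⟩, hae⟩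
    exact ⟨_, ha, Finsupp.support_mono hae⟩
  · rintro ⟨s, hs, hse⟩
    have h1 : ∀ i, (Finsupp.indicator s fun _ _ => 1 : Fin n →₀ ℕ) i ≤ 1 := fun i => by
      rw [Finsupp.indicator_apply]; split_ifs <;> simp
    have h2 : (Finsupp.indicator s fun _ _ => 1 : Fin n →₀ ℕ).support = s := by
      ext i; simp [Finsupp.indicator_apply]
    refine ⟨_, ⟨h1, h2.symm ▸ hs⟩, (Finsupp.le_iff_support_subset_of_le_one h1).2 (h2.symm ▸ hse)⟩

theorem squarefreeIdeal_eq_of_forall_exists {𝒜 ℬ : Set (Finset (Fin n))}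
    (h : ∀ s ∈ 𝒜, ∃ t ∈ ℬ, t ⊆ s) (h' : ∀ s ∈ ℬ, ∃ t ∈ 𝒜, t ⊆ s) :
    squarefreeIdeal K 𝒜 = squarefreeIdeal K ℬ := by
  ext f
  simp only [mem_squarefreeIdeal]
  refine forall₂_congr fun e _ => ⟨?_, ?_⟩
  · rintro ⟨s, hs, hse⟩
    obtain ⟨t, ht, hts⟩ := h s hs
    exact ⟨t, ht, hts.trans hse⟩
  · rintro ⟨s, hs, hse⟩
    obtain ⟨t, ht, hts⟩ := h' s hs
    exact ⟨t, ht, hts.trans hse⟩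

/-- Multiplication by `x` inserts `x` into the support of every exponent, so the colon ideal comes
from deleting `x` from the generators. -/
theorem mem_squarefreeIdeal_erase (𝒜 : Set (Finset (Fin n))) (x : Fin n)
    (f : MvPolynomial (Fin n) K) :
    f ∈ squarefreeIdeal K ((fun s => s.erase x) '' 𝒜) ↔
      MvPolynomial.X x * f ∈ squarefreeIdeal K 𝒜 := by
  have hsupp (e : Fin n →₀ ℕ) : (Finsupp.single x 1 + e).support = insert x e.support := by
    ext i
    by_cases hi : i = x <;> simp [hi, eq_comm]
  simp [mem_squarefreeIdeal, MvPolynomial.support_X_mul, hsupp, Finset.subset_insert_iff]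

theorem squarefreeIdeal_insert (𝒜 : Set (Finset (Fin n))) (x : Fin n) :
    squarefreeIdeal K (insert {x} 𝒜) =
      squarefreeIdeal K 𝒜 ⊔ Ideal.span {MvPolynomial.X x} := by
  have : {a : Fin n →₀ ℕ | (∀ i, a i ≤ 1) ∧ a.support ∈ insert {x} 𝒜} =
      {a | (∀ i, a i ≤ 1) ∧ a.support ∈ 𝒜} ∪ {Finsupp.single x 1} := by
    have hx : ∀ a : Fin n →₀ ℕ, (∀ i, a i ≤ 1) ∧ a.support = {x} ↔ a = Finsupp.single x 1 := by
      intro a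
      constructor
      · rintro ⟨h, hs⟩
        obtain ⟨h0, h1⟩ := Finsupp.support_eq_singleton.1 hs
        rw [h1]
        have := h x
        congr 1
        omega
      · rintro rfl
        refine ⟨fun i => ?_, Finsupp.support_single _ one_ne_zero⟩
        rw [Finsupp.single_apply]; split_ifs <;> simp
    ext a
    simp only [Set.mem_ofPred_eq, Set.mem_insert_iff, Set.mem_union, Set.mem_singleton_iff, ← hx]
    tauto
  rw [squarefreeIdeal, this, squarefreeIdeal, monomialIdeal, monomialIdeal, Set.image_union,
    Ideal.span_union, Set.image_singleton]
  rfl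

theorem squarefreeIdeal_eq_top {𝒜 : Set (Finset (Fin n))} (h : ∅ ∈ 𝒜) :
    squarefreeIdeal K 𝒜 = ⊤ :=
  (Ideal.eq_top_iff_one _).2 (mem_squarefreeIdeal.2 fun _ _ => ⟨∅, h, Finset.empty_subset _⟩)

/-! ### Projective dimension bounds by splitting on variables -/

open CategoryTheory

/-- A variable outside `T` is a nonzerodivisor modulo the ideal: the colon changes nothing, and each
new variable costs at most one. -/
theorem hasProjectiveDimensionLE_squarefreeIdeal_singletons (T : Finset (Fin n)) :
    HasProjectiveDimensionLE (ModuleCat.of (MvPolynomial (Fin n) K)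
      (MvPolynomial (Fin n) K ⧸ squarefreeIdeal K {s | ∃ t ∈ T, s = {t}})) T.card := by
  induction T using Finset.induction_on with
  | empty =>
    have h : squarefreeIdeal K {s : Finset (Fin n) | ∃ t ∈ (∅ : Finset (Fin n)), s = {t}} = ⊥ := by
      rw [eq_bot_iff]
      intro f hf
      rw [mem_squarefreeIdeal] at hf
      simpa [← MvPolynomial.support_eq_empty, Finset.eq_empty_iff_forall_notMem] using hf
    rw [h, Finset.card_empty, ← projective_iff_hasProjectiveDimensionLE_zero]
    have : Module.Projective (MvPolynomial (Fin n) K)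
        (MvPolynomial (Fin n) K ⧸ (⊥ : Ideal (MvPolynomial (Fin n) K))) :=
      Module.Projective.of_equiv (Submodule.quotEquivOfEqBot ⊥ rfl).symm
    exact (IsProjective.iff_projective _).1 this
  | insert x T hx ih =>
    obtain ⟨S, hS, h₁, h₂, h₃⟩ := exists_shortExact_colon _ _ _
      (mem_squarefreeIdeal_erase (K := K) {s | ∃ t ∈ T, s = {t}} x)
    have he : (fun s => s.erase x) '' {s : Finset (Fin n) | ∃ t ∈ T, s = {t}} =
        {s | ∃ t ∈ T, s = {t}} := by
      refine (Set.image_congr (g := id) ?_).trans (Set.image_id _)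
      rintro _ ⟨t, ht, rfl⟩
      have : x ≠ t := fun h => hx (h ▸ ht)
      exact Finset.erase_eq_of_notMem (by simpa using this)
    have hi : {s : Finset (Fin n) | ∃ t ∈ insert x T, s = {t}} =
        insert {x} {s | ∃ t ∈ T, s = {t}} := by
      ext s; simp
    rw [hi, squarefreeIdeal_insert, ← h₃, Finset.card_insert_of_notMem hx]
    rw [he] at h₁
    refine hS.hasProjectiveDimensionLT_X₃ _ (h₁ ▸ ih) ?_
    rw [h₂]
    exact hasProjectiveDimensionLT_of_ge _ (T.card + 1) _ (by omega)

/-- The generators of the ideal either involve a variable of `T` or are products of more than `k`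
variables of `W`. -/
theorem hasProjectiveDimensionLE_squarefreeIdeal (W : Finset (Fin n)) :
    ∀ (T : Finset (Fin n)) (𝒜 : Set (Finset (Fin n))) (k d : ℕ), Disjoint W T →
    (∀ t ∈ T, {t} ∈ 𝒜) →
    (∀ s ∈ 𝒜, (∃ t ∈ T, t ∈ s) ∨ (s ⊆ W ∧ (0 < k → k < s.card))) →
    k ≤ W.card → W.card + T.card ≤ d + k →
    HasProjectiveDimensionLE (ModuleCat.of (MvPolynomial (Fin n) K)
      (MvPolynomial (Fin n) K ⧸ squarefreeIdeal K 𝒜)) d := by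
  -- Leaves of the splitting: the unit ideal, or the ideal of the variables in `T`.
  have hbase : ∀ (T : Finset (Fin n)) (𝒜 : Set (Finset (Fin n))) (d : ℕ),
      (∀ t ∈ T, {t} ∈ 𝒜) → (∀ s ∈ 𝒜, (∃ t ∈ T, t ∈ s) ∨ s = ∅) → T.card ≤ d →
      HasProjectiveDimensionLE (ModuleCat.of (MvPolynomial (Fin n) K)
        (MvPolynomial (Fin n) K ⧸ squarefreeIdeal K 𝒜)) d := by
    intro T 𝒜 d hT h𝒜 hd
    by_cases hempty : ∅ ∈ 𝒜
    · rw [squarefreeIdeal_eq_top hempty]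
      have := (ModuleCat.isZero_of_subsingleton (ModuleCat.of (MvPolynomial (Fin n) K)
        (MvPolynomial (Fin n) K ⧸ (⊤ : Ideal (MvPolynomial (Fin n) K))))).hasProjectiveDimensionLT_zero
      exact hasProjectiveDimensionLT_of_ge _ 0 _ (Nat.zero_le _)
    · rw [squarefreeIdeal_eq_of_forall_exists (ℬ := {s | ∃ t ∈ T, s = {t}})]
      · have := hasProjectiveDimensionLE_squarefreeIdeal_singletons (K := K) T
        exact hasProjectiveDimensionLT_of_ge _ (T.card + 1) _ (by omega)
      · intro s hs
        rcases h𝒜 s hs with ⟨t, ht, hts⟩ | rfl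
        · exact ⟨{t}, ⟨t, ht, rfl⟩, Finset.singleton_subset_iff.2 hts⟩
        · exact absurd hs hempty
      · rintro _ ⟨t, ht, rfl⟩
        exact ⟨{t}, hT t ht, subset_rfl⟩
  induction W using Finset.induction_on with
  | empty =>
    intro T 𝒜 k d _ hT h𝒜 hk hd
    simp only [Finset.card_empty, Nat.le_zero] at hk hd
    refine hbase T 𝒜 d hT (fun s hs => (h𝒜 s hs).imp_right fun h => ?_) (by omega)
    exact Finset.subset_empty.1 h.1
  | insert x W hx ih =>
    intro T 𝒜 k d hWT hT h𝒜 hk hd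
    rw [Finset.disjoint_insert_left] at hWT
    rw [Finset.card_insert_of_notMem hx] at hk hd
    rcases hk.eq_or_lt with hk | hk
    · refine hbase T 𝒜 d hT (fun s hs => (h𝒜 s hs).imp_right fun h => ?_) (by omega)
      have h1 := Finset.card_le_card h.1
      rw [Finset.card_insert_of_notMem hx] at h1
      have h2 := h.2 (by omega)
      omega
    obtain ⟨S, hS, h₁, h₂, h₃⟩ := exists_shortExact_colon _ _ _
      (mem_squarefreeIdeal_erase (K := K) 𝒜 x)
    rw [← squarefreeIdeal_insert] at h₃
    rw [← h₂]
    refine hS.hasProjectiveDimensionLT_X₂ _ ?_ ?_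
    · rw [h₁]
      -- At `k` = 0 the subtraction truncates; deletion may then produce ∅, which is why the degree
      -- condition is imposed only for 0 < `k`.
      refine ih T _ (k - 1) d hWT.2 ?_ ?_ (by omega) (by omega)
      · intro t ht
        have : x ≠ t := fun h => hWT.1 (h ▸ ht)
        exact ⟨{t}, hT t ht, Finset.erase_eq_of_notMem (by simpa using this)⟩
      · rintro _ ⟨s, hs, rfl⟩
        rcases h𝒜 s hs with ⟨t, ht, hts⟩ | ⟨hsW, hsk⟩
        · exact Or.inl ⟨t, ht, Finset.mem_erase.2 ⟨fun h => hWT.1 (h ▸ ht), hts⟩⟩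
        · refine Or.inr ⟨Finset.subset_insert_iff.1 hsW, fun h => ?_⟩
          have h1 := hsk (by omega)
          have h2 := Finset.pred_card_le_card_erase (s := s) (a := x)
          dsimp only
          omega
    · rw [h₃]
      refine ih (insert x T) _ k d ?_ ?_ ?_ (by omega) ?_
      · exact Finset.disjoint_insert_right.2 ⟨hx, hWT.2⟩
      · intro t ht
        rcases Finset.mem_insert.1 ht with rfl | ht
        · exact Set.mem_insert _ _
        · exact Set.mem_insert_of_mem _ (hT t ht)
      · rintro s (rfl | hs)
        · exact Or.inl ⟨x, Finset.mem_insert_self _ _, Finset.mem_singleton_self _⟩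
        · by_cases hxs : x ∈ s
          · exact Or.inl ⟨x, Finset.mem_insert_self _ _, hxs⟩
          rcases h𝒜 s hs with ⟨t, ht, hts⟩ | ⟨hsW, hsk⟩
          · exact Or.inl ⟨t, Finset.mem_insert_of_mem ht, hts⟩
          · exact Or.inr ⟨(Finset.subset_insert_iff_of_notMem hxs).1 hsW, hsk⟩
      · rw [Finset.card_insert_of_notMem hWT.1]
        omega

theorem le_one_of_squarefree_monomial {a : Fin n →₀ ℕ}
    (ha : Squarefree (MvPolynomial.monomial a (1 : K))) (i : Fin n) : a i ≤ 1 := by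
  by_contra! h
  have hdvd : MvPolynomial.X i * MvPolynomial.X i ∣ MvPolynomial.monomial a (1 : K) := by
    rw [MvPolynomial.X, MvPolynomial.monomial_mul, MvPolynomial.monomial_dvd_monomial]
    refine ⟨Or.inr ?_, by simp⟩
    rw [← Finsupp.single_add]
    exact Finsupp.single_le_iff.2 h
  exact (MvPolynomial.X_prime (R := K) (i := i)).not_isUnit (ha _ hdvd)

theorem monomialIdeal_eq_squarefreeIdeal {A : Set (Fin n →₀ ℕ)} (hA : ∀ a ∈ A, ∀ i, a i ≤ 1) :
    monomialIdeal A = squarefreeIdeal K (Finsupp.support '' A) := by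
  ext f
  rw [mem_squarefreeIdeal]
  refine MvPolynomial.mem_ideal_span_monomial_image.trans (forall₂_congr fun e _ => ?_)
  rw [Set.exists_mem_image]
  exact exists_congr fun a => and_congr_right fun ha =>
    Finsupp.le_iff_support_subset_of_le_one (hA a ha)

end squarefreeIdeal

theorem theorem3p1 {K : Type*} [Field K] (n k q : ℕ)
    (m : Fin q → (Fin n →₀ ℕ))
    (M : Ideal (MvPolynomial (Fin n) K))
    (hM : M = monomialIdeal (Set.range m))
    (hsq : IsSquarefreeMonomialIdeal M)
    (hdeg : ∀ j, k < (m j).degree)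
    (hzero : M = ⊥ → k ≤ n) :
    CategoryTheory.projectiveDimension
        (ModuleCat.of (MvPolynomial (Fin n) K) (MvPolynomial (Fin n) K ⧸ M)) +
          (k : WithBot ℕ∞) ≤ (n : WithBot ℕ∞) ∧
      ∀ F : MultigradedFreeResolution M, F.IsMinimal → ∀ i : ℕ, F.rank i ≠ 0 → i + k ≤ n := by
  obtain ⟨A, hA, hMA⟩ := hsq
  have hA1 : ∀ a ∈ A, ∀ i, a i ≤ 1 := fun a ha => le_one_of_squarefree_monomial (hA a ha)
  -- The given `m j` need not be squarefree; each squarefree generator is divisible by some `m j`,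
  -- hence inherits its degree bound.
  have hcard : ∀ a ∈ A, k < a.support.card := by
    intro a ha
    have hmem : MvPolynomial.monomial a (1 : K) ∈ M := by
      rw [hMA]; exact Ideal.subset_span ⟨a, ha, rfl⟩
    rw [hM, monomialIdeal, MvPolynomial.mem_ideal_span_monomial_image] at hmem
    obtain ⟨_, ⟨j, rfl⟩, hj⟩ := hmem a (by simp)
    calc k < (m j).degree := hdeg j
      _ ≤ a.degree := Finsupp.degree_mono hj
      _ ≤ ∑ i ∈ a.support, 1 := Finset.sum_le_sum fun i _ => hA1 a ha i
      _ = a.support.card := by simp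
  have hkn : k ≤ n := by
    rcases A.eq_empty_or_nonempty with rfl | ⟨a, ha⟩
    · exact hzero (by simp [hMA, monomialIdeal])
    · have h := Finset.card_le_univ a.support
      rw [Fintype.card_fin] at h
      exact (hcard a ha).le.trans h
  have hpd : CategoryTheory.HasProjectiveDimensionLE
      (ModuleCat.of (MvPolynomial (Fin n) K) (MvPolynomial (Fin n) K ⧸ M)) (n - k) := by
    rw [hMA, monomialIdeal_eq_squarefreeIdeal hA1]
    refine hasProjectiveDimensionLE_squarefreeIdeal Finset.univ ∅ _ k (n - k)
      (Finset.disjoint_empty_right _) (by simp) ?_ (by simpa using hkn) (by simp; omega)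
    rintro _ ⟨a, ha, rfl⟩
    exact Or.inr ⟨Finset.subset_univ _, fun _ => hcard a ha⟩
  refine ⟨?_, fun F hF i hi => ?_⟩
  · calc _ ≤ ((n - k : ℕ) : WithBot ℕ∞) + (k : WithBot ℕ∞) := by
          gcongr
          exact (CategoryTheory.projectiveDimension_le_iff _ _).2 hpd
      _ = n := by rw [← Nat.cast_add, Nat.sub_add_cancel hkn]
  · by_contra! hlt
    obtain ⟨j, rfl⟩ : ∃ j, i = j + 1 := ⟨i - 1, by omega⟩
    exact hi (hF.rank_succ_eq_zero j
      (CategoryTheory.hasProjectiveDimensionLT_of_ge _ (n - k + 1) _ (by omega)))
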